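/- Let $\Omega\subset\mathbb R^n$ ($n\ge 1$) be a bounded domain, and let $a,b,d,r$ be real numbers with $a+b>0$, $d>0$, $r>0$. Consider the Schnakenberg system $$u_t=\Delta u+r(a-u+u^2v),\qquad v_t=d\,\Delta v+r(b-u^2v)\qquad\text{in }\Omega$$ at its homogeneous steady state $(u_0,v_0)=\big(a+b,\ b/(a+b)^2\big)$, where the deviation from the steady state satisfies either homogeneous Dirichlet or homogeneous Neumann boundary conditions. Let $A=(a_{ij})$ be the Jacobian matrix of the reaction terms at $(u_0,v_0)$, and let $$L(u,v)=(\Delta u+a_{11}u+a_{12}v,\ d\,\Delta v+a_{21}u+a_{22}v)$$ be the linearized operator on the pairs of (complex-valued) functions in $H^2(\Omega)$ that satisfy the boundary condition: in the Dirichlet case membership in $H^1_0(\Omega)$; in the Neumann case $\int_\Omega(\Delta w\,\varphi+\nabla w\cdot\nabla\varphi)\,dx=0$ for all $\varphi\in H^1(\Omega)$, which for regular $\partial\Omega$ says $\partial w/\partial n=0$ on $\partial\Omega$. Eigenvalues of $-\Delta$ refer to the same domain and boundary condition. The system is called *Turing stable* if every eigenvalue of $L$ has negative real part. It *generates Turing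 instability* if every eigenvalue of $A$ has negative real part while $L$ has an eigenvalue with positive real part. Put $$D=rd\,\frac{b-a}{a+b}-r(a+b)^2,\qquad \det A=r^2(a+b)^2,\qquad \beta_\pm=\frac{D\pm\sqrt{D^2-4d\det A}}{2d},$$ $$X=d\,\frac{b-a}{a+b}-(a+b)^2 .$$ If $D^2-4d\det A\le 0$, no real number is regarded as lying strictly between $\beta_-$ and $\beta_+$. Assume $\frac{b-a}{a+b}-(a+b)^2<0$. Then $(u_0,v_0)$ is a steady state, and: 1. If $-\frac{\sqrt{4d}}{r(a+b)}<X<0$, i.e. $\max(d,1)(b-a)<(a+b)^3<d(b-a)+\frac{\sqrt{4d}}{r}$, then the system is Turing stable. 2. If $X>\frac{\sqrt{4d}}{r(a+b)}$, i.e. $b-a<(a+b)^3<d(b-a)-\frac{\sqrt{4d}}{r}$, or $X<-\frac{\sqrt{4d}}{r(a+b)}$, i.e. $\max\big(b-a,\ d(b-a)+\frac{\sqrt{4d}}{r}\big)<(a+b)^3$, then the system generates Turing instability if and only if there is an eigenvalue $\lambda$ of $-\Delta$ with $\beta_-<\lambda<\beta_+$. Here "i.e." asserts the equivalence of the conditions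 under the standing assumptions. The implications in 1 and 2 from the conditions on $X$ also hold with the threshold $\frac{\sqrt{4d}}{r(a+b)}$ replaced by $\sqrt{4d}\,(a+b)$, the value of $|X|$ at which $D^2-4d\det A=0$. -/

import Mathlib

open MeasureTheory Filter Topology
open scoped ContDiff

namespace TuringRD

noncomputable section

/-- The Euclidean space `ℝⁿ`. -/
abbrev Space (n : ℕ) : Type := EuclideanSpace ℝ (Fin n)

/-- The classical partial derivative `∂φ/∂xᵢ` of a complex-valued function on `ℝⁿ`. -/
def partialDeriv {n : ℕ} (i : Fin n) (φ : Space n → ℂ) (x : Space n) : ℂ :=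
  fderiv ℝ φ x (EuclideanSpace.single i 1)

/-- `φ ∈ C_c^∞(Ω)`. -/
structure IsTestFunction {n : ℕ} (Ω : Set (Space n)) (φ : Space n → ℂ) : Prop where
  smooth : ContDiff ℝ ∞ φ
  hasCompactSupport : HasCompactSupport φ
  tsupport_subset : tsupport φ ⊆ Ω

/-- `w ∈ L²(Ω; ℂ)`. -/
def IsL2 {n : ℕ} (Ω : Set (Space n)) (w : Space n → ℂ) : Prop :=
  MemLp w 2 (volume.restrict Ω)

/-- `p` is the weak partial derivative `∂w/∂xᵢ` in `Ω` (both functions are meant to be in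
`L²(Ω)`). -/
def IsWeakPartial {n : ℕ} (Ω : Set (Space n)) (i : Fin n) (w p : Space n → ℂ) : Prop :=
  ∀ φ : Space n → ℂ, IsTestFunction Ω φ →
    ∫ x in Ω, w x * partialDeriv i φ x = - ∫ x in Ω, p x * φ x

/-- `w ∈ H¹(Ω)` and `p = ∇w` (weak gradient). -/
structure IsH1 {n : ℕ} (Ω : Set (Space n)) (w : Space n → ℂ) (p : Fin n → Space n → ℂ) :
    Prop where
  fn_mem : IsL2 Ω w
  grad_mem : ∀ i, IsL2 Ω (p i)
  grad : ∀ i, IsWeakPartial Ω i w (p i)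

/-- `w ∈ H²(Ω)`, `p = ∇w` and `q i j = ∂ⱼ∂ᵢ w` (weak derivatives). -/
structure IsH2 {n : ℕ} (Ω : Set (Space n)) (w : Space n → ℂ) (p : Fin n → Space n → ℂ)
    (q : Fin n → Fin n → Space n → ℂ) : Prop where
  h1 : IsH1 Ω w p
  hess_mem : ∀ i j, IsL2 Ω (q i j)
  hess : ∀ i j, IsWeakPartial Ω j (p i) (q i j)

/-- The two homogeneous boundary conditions: `w = 0` on `∂Ω`, and `∂w/∂n = 0` on `∂Ω`. -/
inductive BoundaryCondition where
  | dirichlet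
  | neumann

/-- The boundary condition for a function `w ∈ H²(Ω)` with gradient `p` and Laplacian `l`.
* Dirichlet: `w ∈ H¹₀(Ω)`, the closure of `C_c^∞(Ω)` in `H¹(Ω)`.
* Neumann: the normal trace of `∇w` vanishes, that is, Green's formula
  `∫_Ω (Δw) φ + ∇w · ∇φ = 0` (whose right-hand side is `∫_{∂Ω} (∂w/∂n) φ` when `∂Ω` is regular)
  holds for every `φ ∈ H¹(Ω)`. -/
def SatisfiesBC {n : ℕ} (Ω : Set (Space n)) (w : Space n → ℂ) (p : Fin n → Space n → ℂ)
    (l : Space n → ℂ) : BoundaryCondition → Prop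
  | .dirichlet => ∃ φ : ℕ → Space n → ℂ, (∀ k, IsTestFunction Ω (φ k)) ∧
      Tendsto (fun k => eLpNorm (w - φ k) 2 (volume.restrict Ω)) atTop (𝓝 0) ∧
      ∀ i, Tendsto (fun k => eLpNorm (p i - partialDeriv i (φ k)) 2 (volume.restrict Ω))
        atTop (𝓝 0)
  | .neumann => ∀ (φ : Space n → ℂ) (s : Fin n → Space n → ℂ), IsH1 Ω φ s →
      ∫ x in Ω, (l x * φ x + ∑ i, p i x * s i x) = 0

/-- `w` lies in `H²(Ω)`, satisfies the boundary condition `bc`, and `Δw = l` in `L²(Ω)`: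
the graph of the Laplacian. -/
def IsLaplacian {n : ℕ} (Ω : Set (Space n)) (bc : BoundaryCondition) (w l : Space n → ℂ) :
    Prop :=
  ∃ (p : Fin n → Space n → ℂ) (q : Fin n → Fin n → Space n → ℂ),
    IsH2 Ω w p q ∧ (l =ᵐ[volume.restrict Ω] fun x => ∑ i, q i i x) ∧ SatisfiesBC Ω w p l bc

/-- The real number `lam` is an eigenvalue of `-Δ` on `Ω` with boundary condition `bc`. -/
def IsNegLaplacianEigenvalue {n : ℕ} (Ω : Set (Space n)) (bc : BoundaryCondition) (lam : ℝ) :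
    Prop :=
  ∃ e l : Space n → ℂ, IsLaplacian Ω bc e l ∧ ¬ (e =ᵐ[volume.restrict Ω] 0) ∧
    (fun x => - l x) =ᵐ[volume.restrict Ω] fun x => (lam : ℂ) * e x

/-- A two-component reaction-diffusion system
`∂u/∂t = Du Δu + f(u,v)`, `∂v/∂t = Dv Δv + g(u,v)`. -/
structure RDSystem where
  Du : ℝ
  Dv : ℝ
  f : ℝ → ℝ → ℝ
  g : ℝ → ℝ → ℝ

namespace RDSystem

/-- `(u₀, v₀)` is a spatially homogeneous steady state. -/
def IsSteadyState (S : RDSystem) (u₀ v₀ : ℝ) : Prop :=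
  S.f u₀ v₀ = 0 ∧ S.g u₀ v₀ = 0

/-- The Jacobian matrix of the reaction terms at `(u₀, v₀)`. -/
def jacobian (S : RDSystem) (u₀ v₀ : ℝ) : Matrix (Fin 2) (Fin 2) ℝ :=
  !![deriv (fun s => S.f s v₀) u₀, deriv (fun s => S.f u₀ s) v₀;
     deriv (fun s => S.g s v₀) u₀, deriv (fun s => S.g u₀ s) v₀]

/-- `β` is an eigenvalue of the linearization
`L(u,v) = (Du Δu + a₁₁u + a₁₂v, Dv Δv + a₂₁u + a₂₂v)`, `(aᵢⱼ)` the Jacobian matrix at `(u₀, v₀)`,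
on the pairs of functions in `H²(Ω)` that satisfy the boundary condition `bc`. -/
def IsLinearizedEigenvalue (S : RDSystem) {n : ℕ} (Ω : Set (Space n)) (bc : BoundaryCondition)
    (u₀ v₀ : ℝ) (β : ℂ) : Prop :=
  let A := S.jacobian u₀ v₀
  ∃ u v lu lv : Space n → ℂ, IsLaplacian Ω bc u lu ∧ IsLaplacian Ω bc v lv ∧
    ¬ (u =ᵐ[volume.restrict Ω] 0 ∧ v =ᵐ[volume.restrict Ω] 0) ∧
    ((fun x => (S.Du : ℂ) * lu x + (A 0 0 : ℂ) * u x + (A 0 1 : ℂ) * v x)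
      =ᵐ[volume.restrict Ω] fun x => β * u x) ∧
    ((fun x => (S.Dv : ℂ) * lv x + (A 1 0 : ℂ) * u x + (A 1 1 : ℂ) * v x)
      =ᵐ[volume.restrict Ω] fun x => β * v x)

/-- The steady state is linearly stable for the system without diffusion: every eigenvalue of the
Jacobian matrix has negative real part. -/
def KineticallyStable (S : RDSystem) (u₀ v₀ : ℝ) : Prop :=
  ∀ z : ℂ, Module.End.HasEigenvalue
    (Matrix.toLin' ((S.jacobian u₀ v₀).map (fun t : ℝ => (t : ℂ)))) z → z.re < 0

/-- Turing stability: every eigenvalue of the linearization of the full system has negative real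
part. -/
def TuringStable (S : RDSystem) {n : ℕ} (Ω : Set (Space n)) (bc : BoundaryCondition)
    (u₀ v₀ : ℝ) : Prop :=
  ∀ β : ℂ, S.IsLinearizedEigenvalue Ω bc u₀ v₀ β → β.re < 0

/-- Turing instability: the steady state is linearly stable without diffusion, but the
linearization of the full system has an eigenvalue with positive real part. -/
def TuringUnstable (S : RDSystem) {n : ℕ} (Ω : Set (Space n)) (bc : BoundaryCondition)
    (u₀ v₀ : ℝ) : Prop :=
  S.KineticallyStable u₀ v₀ ∧ ∃ β : ℂ, S.IsLinearizedEigenvalue Ω bc u₀ v₀ β ∧ 0 < β.re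

end RDSystem

/-- The Schnakenberg system
`∂u/∂t = Δu + r(a - u + u²v)`, `∂v/∂t = dΔv + r(b - u²v)`. -/
def schnakenberg (a b d r : ℝ) : RDSystem where
  Du := 1
  Dv := d
  f u v := r * (a - u + u ^ 2 * v)
  g u v := r * (b - u ^ 2 * v)

/-- `D = rd(b-a)/(a+b) - r(a+b)²`. -/
def schD (a b d r : ℝ) : ℝ := r * d * ((b - a) / (a + b)) - r * (a + b) ^ 2

/-- `det A = r²(a+b)²`. -/
def schDet (a b r : ℝ) : ℝ := r ^ 2 * (a + b) ^ 2

/-- `β₋ = (D - √(D² - 4d det A)) / (2d)`. The real square root of a negative number is `0` here, so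
that no real number lies strictly between `β₋` and `β₊` when the two are not real. -/
def betaMinus (a b d r : ℝ) : ℝ :=
  (schD a b d r - √(schD a b d r ^ 2 - 4 * d * schDet a b r)) / (2 * d)

/-- `β₊ = (D + √(D² - 4d det A)) / (2d)`. -/
def betaPlus (a b d r : ℝ) : ℝ :=
  (schD a b d r + √(schD a b d r ^ 2 - 4 * d * schDet a b r)) / (2 * d)

end

end TuringRD

open TuringRD

/-! The linearization decouples along the eigenvalues `λ` of `-Δ`: `β` is an eigenvalue of `L` iff
it is an eigenvalue of `A - λ diag(1, d)` for some such `λ`. This needs no eigenbasis, hence no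
compactness and no regularity of the boundary. An eigenpair satisfies `Δ(u,v) = M(u,v)` with a
constant matrix `M`, so `Δ` preserves the finite-dimensional span of `u, v`, which must contain an
eigenfunction (`exists_eigenvalue_of_invariant_pair`). Green's formula makes its eigenvalue real,
with `λ ≥ 0`.

For the Schnakenberg system the relation reads `β² + tβ + h(λ) = 0` with `h(λ) = dλ² - Dλ + det A`.
The assumption on the trace and `λ ≥ 0` give `t > 0`, so a root with positive real part exists iff
`h(λ) < 0`, that is, iff `β₋ < λ < β₊`. Moreover `D = rX`, so `X < 0` makes `h` positive on `λ ≥ 0`,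
which is stability. Only the signs of `X` and `h` matter, so both thresholds are covered at once.
The polynomial forms of the ranges come from multiplying by `a + b`. -/

namespace TuringRD

open scoped ComplexConjugate

/-! ### Test functions: conjugation and linear combinations -/

section TestFunctions

variable {n : ℕ} {Ω : Set (Space n)} {φ ψ : Space n → ℂ}

theorem IsTestFunction.differentiable (h : IsTestFunction Ω φ) : Differentiable ℝ φ :=
  h.smooth.differentiable (by simp)

theorem IsTestFunction.isL2 (h : IsTestFunction Ω φ) : IsL2 Ω φ :=
  h.smooth.continuous.memLp_of_hasCompactSupport h.hasCompactSupport

theorem IsTestFunction.isL2_partialDeriv (h : IsTestFunction Ω φ) (i : Fin n) :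
    IsL2 Ω (partialDeriv i φ) := by
  have hc : Continuous (partialDeriv i φ) :=
    (h.smooth.continuous_fderiv (by simp)).clm_apply continuous_const
  have hs : HasCompactSupport (partialDeriv i φ) :=
    (h.hasCompactSupport.fderiv ℝ).comp_left
      (g := fun T : Space n →L[ℝ] ℂ => T (EuclideanSpace.single i 1)) (by simp)
  exact hc.memLp_of_hasCompactSupport hs

theorem partialDeriv_conj (i : Fin n) (φ : Space n → ℂ) (x : Space n) :
    partialDeriv i (fun y => conj (φ y)) x = conj (partialDeriv i φ x) := by
  have h := Complex.conjCLE.comp_fderiv (f := φ) (x := x)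
  have h2 : (fun y => conj (φ y)) = Complex.conjCLE ∘ φ := by ext y; simp
  rw [partialDeriv, h2, h]
  simp [partialDeriv]

theorem partialDeriv_linearCombination (i : Fin n) (hφ : Differentiable ℝ φ)
    (hψ : Differentiable ℝ ψ) (α γ : ℂ) (x : Space n) :
    partialDeriv i (fun y => α * φ y + γ * ψ y) x
      = α * partialDeriv i φ x + γ * partialDeriv i ψ x := by
  have h : HasFDerivAt (fun y => α * φ y + γ * ψ y)
      (α • fderiv ℝ φ x + γ • fderiv ℝ ψ x) x :=
    ((hφ x).hasFDerivAt.const_mul α).add ((hψ x).hasFDerivAt.const_mul γ)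
  rw [partialDeriv, h.fderiv]
  simp [partialDeriv]

theorem IsTestFunction.conj (h : IsTestFunction Ω φ) :
    IsTestFunction Ω (fun x => conj (φ x)) := by
  refine ⟨Complex.conjCLE.contDiff.comp h.smooth,
    h.hasCompactSupport.comp_left (g := fun z : ℂ => (starRingEnd ℂ) z) (by simp), ?_⟩
  exact (closure_mono (Function.support_comp_subset
    (g := fun z : ℂ => (starRingEnd ℂ) z) (by simp) φ)).trans h.tsupport_subset

theorem IsTestFunction.linearCombination (hφ : IsTestFunction Ω φ) (hψ : IsTestFunction Ω ψ)
    (α γ : ℂ) : IsTestFunction Ω (fun x => α * φ x + γ * ψ x) := by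
  refine ⟨(contDiff_const.mul hφ.smooth).add (contDiff_const.mul hψ.smooth),
    (hφ.hasCompactSupport.mul_left (f := fun _ => α)).add
      (hψ.hasCompactSupport.mul_left (f := fun _ => γ)), ?_⟩
  refine (tsupport_add (fun x => α * φ x) (fun x => γ * ψ x)).trans (Set.union_subset ?_ ?_)
  · exact (tsupport_mul_subset_right (f := fun _ => α)).trans hφ.tsupport_subset
  · exact (tsupport_mul_subset_right (f := fun _ => γ)).trans hψ.tsupport_subset

end TestFunctions

/-! ### Sobolev functions, Green's formula and eigenvalues of the Laplacian -/

section Sobolev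

variable {n : ℕ} {Ω : Set (Space n)} {u v w l lu lv : Space n → ℂ}

theorem IsL2.linearCombination (hu : IsL2 Ω u) (hv : IsL2 Ω v) (α γ : ℂ) :
    IsL2 Ω (fun x => α * u x + γ * v x) :=
  (MemLp.const_mul hu α).add (MemLp.const_mul hv γ)

theorem IsL2.conj (hu : IsL2 Ω u) : IsL2 Ω (fun x => conj (u x)) := MemLp.star hu

theorem IsL2.integrable_mul (hu : IsL2 Ω u) (hv : IsL2 Ω v) :
    Integrable (fun x => u x * v x) (volume.restrict Ω) :=
  MemLp.integrable_mul hu hv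

theorem IsWeakPartial.linearCombination {i : Fin n} {p q : Space n → ℂ}
    (hu : IsL2 Ω u) (hv : IsL2 Ω v) (hp : IsL2 Ω p) (hq : IsL2 Ω q)
    (hup : IsWeakPartial Ω i u p) (hvq : IsWeakPartial Ω i v q) (α γ : ℂ) :
    IsWeakPartial Ω i (fun x => α * u x + γ * v x) (fun x => α * p x + γ * q x) := by
  intro φ hφ
  have h1 := hup φ hφ
  have h2 := hvq φ hφ
  have e1 : ∀ x, (α * u x + γ * v x) * partialDeriv i φ x
      = α * (u x * partialDeriv i φ x) + γ * (v x * partialDeriv i φ x) := fun x => by ring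
  have e2 : ∀ x, (α * p x + γ * q x) * φ x = α * (p x * φ x) + γ * (q x * φ x) :=
    fun x => by ring
  simp only [e1, e2]
  rw [integral_add ((hu.integrable_mul (hφ.isL2_partialDeriv i)).const_mul α)
      ((hv.integrable_mul (hφ.isL2_partialDeriv i)).const_mul γ),
    integral_add ((hp.integrable_mul hφ.isL2).const_mul α)
      ((hq.integrable_mul hφ.isL2).const_mul γ)]
  simp only [integral_const_mul]
  rw [h1, h2]
  ring

theorem IsWeakPartial.conj {i : Fin n} {p : Space n → ℂ} (h : IsWeakPartial Ω i w p) :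
    IsWeakPartial Ω i (fun x => conj (w x)) (fun x => conj (p x)) := by
  intro φ hφ
  have h1 := congrArg (starRingEnd ℂ) (h _ hφ.conj)
  simpa [← integral_conj, partialDeriv_conj] using h1

theorem IsH1.linearCombination {p q : Fin n → Space n → ℂ} (hu : IsH1 Ω u p) (hv : IsH1 Ω v q)
    (α γ : ℂ) : IsH1 Ω (fun x => α * u x + γ * v x) (fun i x => α * p i x + γ * q i x) :=
  ⟨hu.fn_mem.linearCombination hv.fn_mem α γ,
    fun i => (hu.grad_mem i).linearCombination (hv.grad_mem i) α γ,
    fun i => (hu.grad i).linearCombination hu.fn_mem hv.fn_mem (hu.grad_mem i) (hv.grad_mem i)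
      (hv.grad i) α γ⟩

theorem IsH1.conj {p : Fin n → Space n → ℂ} (h : IsH1 Ω w p) :
    IsH1 Ω (fun x => conj (w x)) (fun i x => conj (p i x)) :=
  ⟨h.fn_mem.conj, fun i => (h.grad_mem i).conj, fun i => (h.grad i).conj⟩

theorem IsH2.linearCombination {p p' : Fin n → Space n → ℂ} {q q' : Fin n → Fin n → Space n → ℂ}
    (hu : IsH2 Ω u p q) (hv : IsH2 Ω v p' q') (α γ : ℂ) :
    IsH2 Ω (fun x => α * u x + γ * v x) (fun i x => α * p i x + γ * p' i x)
      (fun i j x => α * q i j x + γ * q' i j x) :=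
  ⟨hu.h1.linearCombination hv.h1 α γ,
    fun i j => (hu.hess_mem i j).linearCombination (hv.hess_mem i j) α γ,
    fun i j => (hu.hess i j).linearCombination (hu.h1.grad_mem i) (hv.h1.grad_mem i)
      (hu.hess_mem i j) (hv.hess_mem i j) (hv.hess i j) α γ⟩

theorem IsH2.isL2_laplacian {p : Fin n → Space n → ℂ} {q : Fin n → Fin n → Space n → ℂ}
    (h : IsH2 Ω w p q) (hl : l =ᵐ[volume.restrict Ω] fun x => ∑ i, q i i x) : IsL2 Ω l :=
  (memLp_congr_ae hl).2 (memLp_finsetSum _ fun i _ => h.hess_mem i i)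

theorem tendsto_eLpNorm_linearCombination {f g : Space n → ℂ} {F G : ℕ → Space n → ℂ}
    (hf : IsL2 Ω f) (hg : IsL2 Ω g) (hF : ∀ k, IsL2 Ω (F k)) (hG : ∀ k, IsL2 Ω (G k))
    (hfF : Tendsto (fun k => eLpNorm (f - F k) 2 (volume.restrict Ω)) atTop (𝓝 0))
    (hgG : Tendsto (fun k => eLpNorm (g - G k) 2 (volume.restrict Ω)) atTop (𝓝 0)) (α γ : ℂ) :
    Tendsto (fun k => eLpNorm ((fun x => α * f x + γ * g x) - fun x => α * F k x + γ * G k x) 2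
      (volume.restrict Ω)) atTop (𝓝 0) := by
  have hlim : Tendsto (fun k => ‖α‖ₑ * eLpNorm (f - F k) 2 (volume.restrict Ω)
      + ‖γ‖ₑ * eLpNorm (g - G k) 2 (volume.restrict Ω)) atTop (𝓝 0) := by
    have h1 := ENNReal.Tendsto.const_mul (a := ‖α‖ₑ) hfF (Or.inr enorm_ne_top)
    have h2 := ENNReal.Tendsto.const_mul (a := ‖γ‖ₑ) hgG (Or.inr enorm_ne_top)
    simpa using h1.add h2
  refine tendsto_of_tendsto_of_tendsto_of_le_of_le tendsto_const_nhds hlim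
    (fun _ => zero_le) fun k => ?_
  have e : ((fun x => α * f x + γ * g x) - fun x => α * F k x + γ * G k x)
      = α • (f - F k) + γ • (g - G k) := by
    ext x; simp only [Pi.sub_apply, Pi.add_apply, Pi.smul_apply, smul_eq_mul]; ring
  rw [e]
  refine (eLpNorm_add_le (((MemLp.sub hf (hF k)).const_smul α).aestronglyMeasurable)
    (((MemLp.sub hg (hG k)).const_smul γ).aestronglyMeasurable) (by norm_num)).trans ?_
  rw [eLpNorm_const_smul, eLpNorm_const_smul]

/-- Both boundary conditions are linear: approximating sequences in `H¹₀` combine termwise, and the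
Neumann identity is linear in `(w, ∇w, Δw)`. This allows eigenfunctions to be sought in the span of
`u` and `v`. -/
theorem IsLaplacian.linearCombination {bc : BoundaryCondition} (hu : IsLaplacian Ω bc u lu)
    (hv : IsLaplacian Ω bc v lv) (α γ : ℂ) :
    IsLaplacian Ω bc (fun x => α * u x + γ * v x) (fun x => α * lu x + γ * lv x) := by
  obtain ⟨p, q, h2, hq, hbc⟩ := hu
  obtain ⟨p', q', h2', hq', hbc'⟩ := hv
  refine ⟨_, _, h2.linearCombination h2' α γ, ?_, ?_⟩
  · filter_upwards [hq, hq'] with x hx hx'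
    rw [hx, hx', Finset.mul_sum, Finset.mul_sum, Finset.sum_add_distrib]
  cases bc with
  | dirichlet =>
    obtain ⟨φ, hφ, h0, h1⟩ := hbc
    obtain ⟨ψ, hψ, h0', h1'⟩ := hbc'
    refine ⟨fun k x => α * φ k x + γ * ψ k x, fun k => (hφ k).linearCombination (hψ k) α γ,
      tendsto_eLpNorm_linearCombination h2.h1.fn_mem h2'.h1.fn_mem (fun k => (hφ k).isL2)
        (fun k => (hψ k).isL2) h0 h0' α γ, fun i => ?_⟩
    have := tendsto_eLpNorm_linearCombination (h2.h1.grad_mem i) (h2'.h1.grad_mem i)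
      (fun k => (hφ k).isL2_partialDeriv i) (fun k => (hψ k).isL2_partialDeriv i)
      (h1 i) (h1' i) α γ
    have e : ∀ k, partialDeriv i (fun x => α * φ k x + γ * ψ k x)
        = fun x => α * partialDeriv i (φ k) x + γ * partialDeriv i (ψ k) x := fun k =>
      funext fun x =>
        partialDeriv_linearCombination i (hφ k).differentiable (hψ k).differentiable α γ x
    simpa only [e] using this
  | neumann =>
    intro φ s hs
    have hi := (h2.isL2_laplacian hq).integrable_mul hs.fn_mem
    have hi' := (h2'.isL2_laplacian hq').integrable_mul hs.fn_mem
    have hg := integrable_finsetSum (μ := volume.restrict Ω) Finset.univ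
      fun i _ => (h2.h1.grad_mem i).integrable_mul (hs.grad_mem i)
    have hg' := integrable_finsetSum (μ := volume.restrict Ω) Finset.univ
      fun i _ => (h2'.h1.grad_mem i).integrable_mul (hs.grad_mem i)
    have e : ∀ x, (α * lu x + γ * lv x) * φ x + ∑ i, (α * p i x + γ * p' i x) * s i x
        = α * (lu x * φ x + ∑ i, p i x * s i x) + γ * (lv x * φ x + ∑ i, p' i x * s i x) := by
      intro x
      simp only [add_mul, Finset.sum_add_distrib, mul_add, Finset.mul_sum, mul_assoc]
      ring
    simp only [e]
    rw [integral_add (Integrable.const_mul (by exact hi.add hg) α)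
        (Integrable.const_mul (by exact hi'.add hg') γ),
      integral_const_mul, integral_const_mul, hbc φ s hs, hbc' φ s hs]
    simp

/-- The `L²`-pairing is continuous along sequences converging in `L²`. -/
theorem tendsto_integral_mul_conj {f g : Space n → ℂ} {F : ℕ → Space n → ℂ}
    (hg : IsL2 Ω g) (hf : IsL2 Ω f) (hF : ∀ k, IsL2 Ω (F k))
    (hfF : Tendsto (fun k => eLpNorm (f - F k) 2 (volume.restrict Ω)) atTop (𝓝 0)) :
    Tendsto (fun k => ∫ x in Ω, g x * conj (F k x)) atTop (𝓝 (∫ x in Ω, g x * conj (f x))) := by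
  refine tendsto_integral_of_L1' _ (hg.integrable_mul hf.conj).aestronglyMeasurable
    (Eventually.of_forall fun k => hg.integrable_mul (hF k).conj) ?_
  have hlim := ENNReal.Tendsto.const_mul hfF (Or.inr hg.eLpNorm_ne_top)
  rw [mul_zero] at hlim
  refine tendsto_of_tendsto_of_tendsto_of_le_of_le tendsto_const_nhds hlim
    (fun _ => zero_le) fun k => ?_
  have hd : MemLp (f - F k) 2 (volume.restrict Ω) := MemLp.sub hf (hF k)
  -- Hölder's inequality with `1 = 1/2 + 1/2`.
  refine le_trans (le_of_eq ?_) (eLpNorm_smul_le_mul_eLpNorm (p := 2) (q := 2) (r := 1)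
    hd.aestronglyMeasurable hg.aestronglyMeasurable)
  refine eLpNorm_congr_norm_ae (Eventually.of_forall fun x => ?_)
  simp only [Pi.sub_apply, Pi.smul_apply', smul_eq_mul]
  rw [← mul_sub, ← map_sub, norm_mul, norm_mul, RCLike.norm_conj, norm_sub_rev]

/-- Green's formula `∫ Δw w̄ + |∇w|² = 0`. -/
theorem IsLaplacian.green {bc : BoundaryCondition} (h : IsLaplacian Ω bc w l) :
    ∃ p : Fin n → Space n → ℂ, (∀ i, IsL2 Ω (p i)) ∧
      (∫ x in Ω, l x * conj (w x)) + ∑ i, ∫ x in Ω, p i x * conj (p i x) = 0 := by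
  obtain ⟨p, q, h2, hq, hbc⟩ := h
  refine ⟨p, h2.h1.grad_mem, ?_⟩
  have hl := h2.isL2_laplacian hq
  have hp := h2.h1.grad_mem
  cases bc with
  | neumann =>
    have h0 := hbc _ _ h2.h1.conj
    rwa [integral_add (hl.integrable_mul h2.h1.fn_mem.conj)
      (integrable_finsetSum _ fun i _ => (hp i).integrable_mul (hp i).conj),
      integral_finsetSum _ fun i _ => (hp i).integrable_mul (hp i).conj] at h0
  | dirichlet =>
    obtain ⟨φ, hφ, h0, h1⟩ := hbc
    have hlim := (tendsto_integral_mul_conj hl h2.h1.fn_mem (fun k => (hφ k).isL2) h0).add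
      (tendsto_finsetSum Finset.univ fun i _ => tendsto_integral_mul_conj (hp i) (hp i)
        (fun k => (hφ k).isL2_partialDeriv i) (h1 i))
    -- With `w` replaced by the test function `φ k` in the second slot, the identity is the
    -- definition of the weak derivative of `p i`, so the sequence is constantly `0`.
    refine tendsto_nhds_unique hlim (tendsto_const_nhds.congr fun k => ?_)
    have e : ∫ x in Ω, l x * conj (φ k x) = ∑ i, ∫ x in Ω, q i i x * conj (φ k x) := by
      rw [← integral_finsetSum _ fun i _ => (h2.hess_mem i i).integrable_mul (hφ k).isL2.conj]
      refine integral_congr_ae ?_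
      filter_upwards [hq] with x hx
      rw [hx, Finset.sum_mul]
    rw [e, ← Finset.sum_add_distrib]
    refine (Finset.sum_eq_zero fun i _ => ?_).symm
    have := h2.hess i i _ (hφ k).conj
    simp only [partialDeriv_conj] at this
    rw [this, add_neg_cancel]

theorem integral_mul_conj_self (w : Space n → ℂ) :
    ∫ x in Ω, w x * conj (w x) = ((∫ x in Ω, ‖w x‖ ^ 2 : ℝ) : ℂ) := by
  rw [← integral_complex_ofReal]
  simp [Complex.mul_conj']

/-- The eigenvalues of the Laplacian are real and nonpositive. -/
theorem IsLaplacian.exists_eigenvalue_eq_neg {bc : BoundaryCondition} (h : IsLaplacian Ω bc w l)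
    (hw : ¬ w =ᵐ[volume.restrict Ω] 0) (hL2 : IsL2 Ω w) {μ : ℂ}
    (hl : l =ᵐ[volume.restrict Ω] fun x => μ * w x) :
    ∃ lam : ℝ, 0 ≤ lam ∧ μ = -(lam : ℂ) := by
  obtain ⟨p, -, hp⟩ := h.green
  have e : ∫ x in Ω, l x * conj (w x) = μ * ∫ x in Ω, w x * conj (w x) := by
    rw [← integral_const_mul]
    refine integral_congr_ae ?_
    filter_upwards [hl] with x hx
    rw [hx, mul_assoc]
  simp only [e, integral_mul_conj_self, ← Complex.ofReal_sum] at hp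
  have hpos : ∫ x in Ω, ‖w x‖ ^ 2 ≠ 0 := by
    intro h0
    rw [integral_eq_zero_iff_of_nonneg (fun x => by positivity)
      ((memLp_two_iff_integrable_sq_norm hL2.aestronglyMeasurable).1 hL2)] at h0
    refine hw ?_
    filter_upwards [h0] with x hx
    simpa using hx
  -- The Rayleigh quotient of `w`.
  refine ⟨(∑ i, ∫ x in Ω, ‖p i x‖ ^ 2) / ∫ x in Ω, ‖w x‖ ^ 2,
    div_nonneg (Finset.sum_nonneg fun i _ => integral_nonneg fun x => by positivity)
      (integral_nonneg fun x => by positivity), ?_⟩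
  have hpos' : ((∫ x in Ω, ‖w x‖ ^ 2 : ℝ) : ℂ) ≠ 0 := by exact_mod_cast hpos
  rw [Complex.ofReal_div, ← neg_div, eq_div_iff hpos']
  exact eq_neg_of_add_eq_zero_left hp

theorem IsLaplacian.isL2 {bc : BoundaryCondition} (h : IsLaplacian Ω bc w l) : IsL2 Ω w := by
  obtain ⟨p, q, h2, -⟩ := h
  exact h2.h1.fn_mem

theorem IsNegLaplacianEigenvalue.nonneg {bc : BoundaryCondition} {lam : ℝ}
    (h : IsNegLaplacianEigenvalue Ω bc lam) : 0 ≤ lam := by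
  obtain ⟨e, l, hl, he, hel⟩ := h
  obtain ⟨lam', h0, h1⟩ := hl.exists_eigenvalue_eq_neg he hl.isL2 (μ := -(lam : ℂ)) (by
    filter_upwards [hel] with x hx
    rw [neg_mul, ← hx, neg_neg])
  have : lam = lam' := by exact_mod_cast neg_injective h1
  exact this ▸ h0

/-- Since complex eigenvalues are automatically real, defining eigenvalues of `-Δ` through a real
parameter loses nothing. -/
theorem IsLaplacian.isNegLaplacianEigenvalue {bc : BoundaryCondition} (h : IsLaplacian Ω bc w l)
    (hw : ¬ w =ᵐ[volume.restrict Ω] 0) {μ : ℂ} (hl : l =ᵐ[volume.restrict Ω] fun x => μ * w x) :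
    ∃ lam : ℝ, IsNegLaplacianEigenvalue Ω bc lam ∧ μ = -(lam : ℂ) := by
  obtain ⟨lam, -, h1⟩ := h.exists_eigenvalue_eq_neg hw h.isL2 hl
  refine ⟨lam, ⟨w, l, h, hw, ?_⟩, h1⟩
  filter_upwards [hl] with x hx
  rw [hx, h1]
  ring

end Sobolev

/-! ### Reduction of the linearization to 2×2 matrices -/

section ReactionDiffusion

variable {n : ℕ} {Ω : Set (Space n)} {bc : BoundaryCondition}

/-- A solution `(u, v) ≠ 0` of `Δu = m₁₁u + m₁₂v`, `Δv = m₂₁u + m₂₂v` with `m₁₂ ≠ 0` yields an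
eigenvalue of the Laplacian among the eigenvalues of `(mᵢⱼ)`. -/
theorem exists_eigenvalue_of_invariant_pair {u v lu lv : Space n → ℂ} {m₁₁ m₁₂ m₂₁ m₂₂ : ℂ}
    (hu : IsLaplacian Ω bc u lu) (hv : IsLaplacian Ω bc v lv)
    (hne : ¬ (u =ᵐ[volume.restrict Ω] 0 ∧ v =ᵐ[volume.restrict Ω] 0)) (h12 : m₁₂ ≠ 0)
    (h1 : lu =ᵐ[volume.restrict Ω] fun x => m₁₁ * u x + m₁₂ * v x)
    (h2 : lv =ᵐ[volume.restrict Ω] fun x => m₂₁ * u x + m₂₂ * v x) :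
    ∃ lam : ℝ, IsNegLaplacianEigenvalue Ω bc lam ∧
      (m₁₁ + lam) * (m₂₂ + lam) - m₁₂ * m₂₁ = 0 := by
  obtain ⟨s, hs⟩ := IsAlgClosed.exists_eq_mul_self (discrim 1 (-(m₁₁ + m₂₂)) (m₁₁ * m₂₂ - m₁₂ * m₂₁))
  -- The eigenvalues of `(mᵢⱼ)`, given by their sum and product.
  obtain ⟨μ₁, μ₂, hsum, hprod⟩ : ∃ μ₁ μ₂ : ℂ, μ₁ + μ₂ = m₁₁ + m₂₂ ∧
      μ₁ * μ₂ = m₁₁ * m₂₂ - m₁₂ * m₂₁ := by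
    refine ⟨(m₁₁ + m₂₂ + s) / 2, (m₁₁ + m₂₂ - s) / 2, by ring, ?_⟩
    rw [discrim] at hs
    linear_combination hs / 4
  have key : ∀ μ lam : ℂ, (μ = μ₁ ∨ μ = μ₂) → μ = -lam →
      (m₁₁ + lam) * (m₂₂ + lam) - m₁₂ * m₂₁ = 0 := by
    rintro μ lam hμ rfl
    have : (-lam - μ₁) * (-lam - μ₂) = 0 := by
      rcases hμ with h | h <;> rw [h] <;> ring
    linear_combination this - lam * hsum - hprod
  -- This function is `y = (Δ - μ₂)u`, and Cayley–Hamilton gives `(Δ - μ₁)y = 0`. Either `y` is an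
  -- eigenfunction, or `y = 0` and `u` is one; in the latter case `u = 0` would force `v = 0`
  -- because `m₁₂ ≠ 0`.
  by_cases hy : (fun x => (m₁₁ - μ₂) * u x + m₁₂ * v x) =ᵐ[volume.restrict Ω] 0
  · have hu0 : ¬ u =ᵐ[volume.restrict Ω] 0 := fun hu0 => hne ⟨hu0, by
      filter_upwards [hu0, hy] with x hx hx'
      simpa [hx, h12] using hx'⟩
    obtain ⟨lam, hlam, hμ⟩ := hu.isNegLaplacianEigenvalue hu0 (μ := μ₂) (by
      filter_upwards [h1, hy] with x hx hx'
      simp only [Pi.zero_apply] at hx'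
      rw [hx]
      linear_combination hx')
    exact ⟨lam, hlam, key _ _ (Or.inr rfl) hμ⟩
  · obtain ⟨lam, hlam, hμ⟩ := (hu.linearCombination hv (m₁₁ - μ₂) m₁₂).isNegLaplacianEigenvalue
      hy (μ := μ₁) (by
        filter_upwards [h1, h2] with x hx hx'
        rw [hx, hx']
        linear_combination (-m₁₁ * u x - m₁₂ * v x) * hsum + u x * hprod)
    exact ⟨lam, hlam, key _ _ (Or.inl rfl) hμ⟩

/-- The spectrum of the linearization is determined by the eigenvalues of the Laplacian: its
elements are the eigenvalues of the matrices `A - λ diag(Du, Dv)`. -/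
theorem RDSystem.isLinearizedEigenvalue_iff (S : RDSystem) {u₀ v₀ : ℝ} {β : ℂ}
    (hDu : S.Du ≠ 0) (hDv : S.Dv ≠ 0) (h01 : S.jacobian u₀ v₀ 0 1 ≠ 0) :
    S.IsLinearizedEigenvalue Ω bc u₀ v₀ β ↔ ∃ lam : ℝ, IsNegLaplacianEigenvalue Ω bc lam ∧
      (β - S.jacobian u₀ v₀ 0 0 + S.Du * lam) * (β - S.jacobian u₀ v₀ 1 1 + S.Dv * lam)
        - (S.jacobian u₀ v₀ 0 1 : ℂ) * S.jacobian u₀ v₀ 1 0 = 0 := by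
  have hU : (S.Du : ℂ) ≠ 0 := by exact_mod_cast hDu
  have hV : (S.Dv : ℂ) ≠ 0 := by exact_mod_cast hDv
  have hA : (S.jacobian u₀ v₀ 0 1 : ℂ) ≠ 0 := by exact_mod_cast h01
  unfold RDSystem.IsLinearizedEigenvalue
  generalize S.jacobian u₀ v₀ = A at *
  constructor
  · rintro ⟨u, v, lu, lv, hu, hv, hne, h1, h2⟩
    obtain ⟨lam, hlam, h⟩ := exists_eigenvalue_of_invariant_pair hu hv hne
      (m₁₁ := (β - A 0 0) / S.Du) (m₁₂ := -A 0 1 / S.Du) (m₂₁ := -A 1 0 / S.Dv)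
      (m₂₂ := (β - A 1 1) / S.Dv) (div_ne_zero (neg_ne_zero.2 hA) hU)
      (by
        filter_upwards [h1] with x hx
        field_simp
        linear_combination hx)
      (by
        filter_upwards [h2] with x hx
        field_simp
        linear_combination hx)
    refine ⟨lam, hlam, ?_⟩
    field_simp at h
    linear_combination h
  · rintro ⟨lam, ⟨e, l, hl, he, hel⟩, h⟩
    have hel' : ∀ᵐ x ∂(volume.restrict Ω), l x = -(lam * e x) := by
      filter_upwards [hel] with x hx
      rw [← hx, neg_neg]
    -- The vector `(a₁₂, β - a₁₁ + Du λ)` solves the first row of `(A - λ diag(Du, Dv))ξ = βξ`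
    -- identically and the second by the determinant condition; it is nonzero because `a₁₂ ≠ 0`.
    refine ⟨_, _, _, _, hl.linearCombination hl (A 0 1) 0,
      hl.linearCombination hl (β - A 0 0 + S.Du * lam) 0, ?_, ?_, ?_⟩
    · rintro ⟨h0, -⟩
      refine he ?_
      filter_upwards [h0] with x hx
      simpa [hA] using hx
    · filter_upwards [hel'] with x hx
      rw [hx]
      ring
    · filter_upwards [hel'] with x hx
      rw [hx]
      linear_combination -e x * h

end ReactionDiffusion

/-! ### Root location for real quadratics -/

section Quadratic

/-- The roots of a real quadratic `z² + t z + c` with `t, c > 0` have negative real part. -/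
theorem re_neg_of_quadratic_eq_zero {t c : ℝ} (ht : 0 < t) (hc : 0 < c) {z : ℂ}
    (h : z ^ 2 + t * z + c = 0) : z.re < 0 := by
  have hre := congrArg Complex.re h
  have him := congrArg Complex.im h
  simp [pow_two] at hre him
  by_contra! hz
  have hi : z.im = 0 := by
    -- The imaginary part of the equation: if `z.re ≥ 0`, the second factor is positive, so `z` is
    -- real, and then the left side of the quadratic is positive.
    have : z.im * (2 * z.re + t) = 0 := by linarith
    rcases mul_eq_zero.1 this with h | h
    · exact h
    · linarith
  rw [hi] at hre
  nlinarith [mul_nonneg ht.le hz, mul_self_nonneg z.re]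

/-- A real quadratic `z² + t z + c` with `t > 0` has a root with positive real part if and only
if `c < 0`. -/
theorem exists_root_re_pos_iff {t c : ℝ} (ht : 0 < t) :
    (∃ z : ℂ, z ^ 2 + t * z + c = 0 ∧ 0 < z.re) ↔ c < 0 := by
  constructor
  · rintro ⟨z, h, hz⟩
    by_contra! hc
    rcases hc.eq_or_lt with rfl | hc
    · have : z * (z + t) = 0 := by
        rw [Complex.ofReal_zero] at h
        linear_combination h
      rcases mul_eq_zero.1 this with h | h
      · simp [h] at hz
      · have := congrArg Complex.re h
        simp at this
        linarith
    · exact (re_neg_of_quadratic_eq_zero ht hc h).not_gt hz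
  · intro hc
    have hs := Real.sq_sqrt (show 0 ≤ t ^ 2 - 4 * c by nlinarith)
    have hlt : t < √(t ^ 2 - 4 * c) := Real.lt_sqrt_of_sq_lt (by linarith)
    refine ⟨((√(t ^ 2 - 4 * c) - t) / 2 : ℝ), ?_, ?_⟩
    · norm_cast
      linear_combination hs / 4
    · rw [Complex.ofReal_re]
      linarith

/-- The quadratic `d x² - D x + c` is negative exactly between its real roots. -/
theorem quadratic_neg_iff {d D c x : ℝ} (hd : 0 < d) :
    d * x ^ 2 - D * x + c < 0 ↔
      (D - √(D ^ 2 - 4 * d * c)) / (2 * d) < x ∧ x < (D + √(D ^ 2 - 4 * d * c)) / (2 * d) := by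
  have h1 : d * x ^ 2 - D * x + c < 0 ↔ (2 * d * x - D) ^ 2 < D ^ 2 - 4 * d * c := by
    constructor <;> intro h <;> nlinarith
  -- `Real.sq_lt` is valid without a sign condition on the discriminant: for a negative one the root
  -- is `0` and both sides are false.
  rw [h1, Real.sq_lt, div_lt_iff₀ (by positivity), lt_div_iff₀ (by positivity)]
  constructor <;> rintro ⟨h, h'⟩ <;> constructor <;> linarith

end Quadratic

end TuringRD

namespace TuringRD

/-! ### The Schnakenberg system -/

section Schnakenberg

variable {n : ℕ} {Ω : Set (Space n)} {bc : BoundaryCondition} {a b d r : ℝ}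

/-- The characteristic polynomial is `z² - (tr A) z + det A`. -/
theorem RDSystem.kineticallyStable_of_trace_neg_of_det_pos (S : RDSystem) {u₀ v₀ : ℝ}
    (htr : (S.jacobian u₀ v₀).trace < 0) (hdet : 0 < (S.jacobian u₀ v₀).det) :
    S.KineticallyStable u₀ v₀ := by
  intro z hz
  rw [Module.End.hasEigenvalue_iff_isRoot_charpoly, Matrix.charpoly_toLin',
    Matrix.charpoly_fin_two] at hz
  rw [Matrix.trace_fin_two] at htr
  rw [Matrix.det_fin_two] at hdet
  refine re_neg_of_quadratic_eq_zero (neg_pos.2 htr) hdet ?_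
  simp [Matrix.trace_fin_two, Matrix.det_fin_two] at hz
  push_cast
  linear_combination hz

theorem schnakenberg_isSteadyState (hab : a + b ≠ 0) :
    (schnakenberg a b d r).IsSteadyState (a + b) (b / (a + b) ^ 2) := by
  constructor <;> simp only [schnakenberg] <;> field_simp <;> ring

theorem schnakenberg_jacobian (hab : a + b ≠ 0) :
    (schnakenberg a b d r).jacobian (a + b) (b / (a + b) ^ 2) =
      !![r * ((b - a) / (a + b)), r * (a + b) ^ 2;
        -(2 * r * b / (a + b)), -(r * (a + b) ^ 2)] := by
  have hsq : ∀ x : ℝ, HasDerivAt (fun s : ℝ => s ^ 2) (2 * x) x := fun x => by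
    simpa using hasDerivAt_pow 2 x
  have h00 : HasDerivAt (fun s => r * (a - s + s ^ 2 * (b / (a + b) ^ 2)))
      (r * (-1 + 2 * (a + b) * (b / (a + b) ^ 2))) (a + b) :=
    (((hasDerivAt_id (a + b)).const_sub a).add ((hsq _).mul_const _)).const_mul r
  have h01 : HasDerivAt (fun s => r * (a - (a + b) + (a + b) ^ 2 * s))
      (r * ((a + b) ^ 2 * 1)) (b / (a + b) ^ 2) :=
    (((hasDerivAt_id _).const_mul _).const_add _).const_mul r
  have h10 : HasDerivAt (fun s => r * (b - s ^ 2 * (b / (a + b) ^ 2)))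
      (r * (-(2 * (a + b) * (b / (a + b) ^ 2)))) (a + b) :=
    (((hsq _).mul_const _).const_sub _).const_mul r
  have h11 : HasDerivAt (fun s => r * (b - (a + b) ^ 2 * s))
      (r * (-((a + b) ^ 2 * 1))) (b / (a + b) ^ 2) :=
    (((hasDerivAt_id _).const_mul _).const_sub _).const_mul r
  have e00 : r * (-1 + 2 * (a + b) * (b / (a + b) ^ 2)) = r * ((b - a) / (a + b)) := by
    field_simp
    ring
  have e10 : r * (-(2 * (a + b) * (b / (a + b) ^ 2))) = -(2 * r * b / (a + b)) := by
    field_simp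
  simp only [RDSystem.jacobian, schnakenberg]
  rw [h00.deriv, h01.deriv, h10.deriv, h11.deriv, e00, e10, mul_one, mul_neg]

theorem schnakenberg_det (hab : a + b ≠ 0) :
    r * ((b - a) / (a + b)) * -(r * (a + b) ^ 2) - r * (a + b) ^ 2 * -(2 * r * b / (a + b))
      = schDet a b r := by
  rw [schDet]
  field_simp
  ring

theorem schnakenberg_kineticallyStable (hab : 0 < a + b) (hr : 0 < r)
    (htr : (b - a) / (a + b) - (a + b) ^ 2 < 0) :
    (schnakenberg a b d r).KineticallyStable (a + b) (b / (a + b) ^ 2) := by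
  refine RDSystem.kineticallyStable_of_trace_neg_of_det_pos _ ?_ ?_
  · rw [schnakenberg_jacobian hab.ne', Matrix.trace_fin_two_of]
    linarith [mul_neg_of_pos_of_neg hr htr]
  · rw [schnakenberg_jacobian hab.ne', Matrix.det_fin_two_of, schnakenberg_det hab.ne', schDet]
    positivity

/-- The dispersion relation of the Schnakenberg system. -/
theorem schnakenberg_isLinearizedEigenvalue_iff (hab : 0 < a + b) (hd : 0 < d) (hr : 0 < r)
    {β : ℂ} :
    (schnakenberg a b d r).IsLinearizedEigenvalue Ω bc (a + b) (b / (a + b) ^ 2) β ↔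
      ∃ lam : ℝ, IsNegLaplacianEigenvalue Ω bc lam ∧
        β ^ 2 + ((1 + d) * lam - r * ((b - a) / (a + b) - (a + b) ^ 2) : ℝ) * β
          + (d * lam ^ 2 - schD a b d r * lam + schDet a b r : ℝ) = 0 := by
  have hJ := schnakenberg_jacobian (d := d) (r := r) hab.ne'
  rw [RDSystem.isLinearizedEigenvalue_iff _ (by simp [schnakenberg])
    (by simpa [schnakenberg] using hd.ne')
    (by rw [hJ]; simpa using ⟨hr.ne', hab.ne'⟩)]
  refine exists_congr fun lam => and_congr_right fun _ => Eq.congr_left ?_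
  rw [hJ, ← schnakenberg_det hab.ne', schD]
  simp only [schnakenberg, Matrix.of_apply, Matrix.cons_val', Matrix.cons_val_zero,
    Matrix.cons_val_one, Matrix.cons_val_fin_one]
  push_cast
  ring

/-- The quantity is `-tr(A - λ diag(1, d))`, the coefficient of `β` in the dispersion relation;
diffusion only increases it. -/
theorem schnakenberg_damping_pos (hd : 0 < d) (hr : 0 < r)
    (htr : (b - a) / (a + b) - (a + b) ^ 2 < 0) {lam : ℝ} (hlam : 0 ≤ lam) :
    0 < (1 + d) * lam - r * ((b - a) / (a + b) - (a + b) ^ 2) := by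
  have := mul_neg_of_pos_of_neg hr htr
  have : 0 ≤ (1 + d) * lam := by positivity
  linarith

/-- As `D = rX < 0`, each term of `dλ² - Dλ + det A` is nonnegative for `λ ≥ 0`, and the last is
positive. -/
theorem schnakenberg_turingStable (hab : 0 < a + b) (hd : 0 < d) (hr : 0 < r)
    (htr : (b - a) / (a + b) - (a + b) ^ 2 < 0)
    (hX : d * ((b - a) / (a + b)) - (a + b) ^ 2 < 0) :
    (schnakenberg a b d r).TuringStable Ω bc (a + b) (b / (a + b) ^ 2) := by
  intro β hβ
  obtain ⟨lam, hlam, h⟩ := (schnakenberg_isLinearizedEigenvalue_iff hab hd hr).1 hβ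
  have h0 := hlam.nonneg
  refine re_neg_of_quadratic_eq_zero (schnakenberg_damping_pos hd hr htr h0) ?_ h
  have hD : schD a b d r < 0 := by
    rw [schD]
    linarith [mul_neg_of_pos_of_neg hr hX]
  have hdet : 0 < schDet a b r := by
    rw [schDet]
    positivity
  linarith [mul_nonneg (neg_nonneg.2 hD.le) h0, mul_nonneg hd.le (sq_nonneg lam)]

theorem schnakenberg_turingUnstable_iff (hab : 0 < a + b) (hd : 0 < d) (hr : 0 < r)
    (htr : (b - a) / (a + b) - (a + b) ^ 2 < 0) :
    (schnakenberg a b d r).TuringUnstable Ω bc (a + b) (b / (a + b) ^ 2) ↔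
      ∃ lam : ℝ, IsNegLaplacianEigenvalue Ω bc lam ∧
        betaMinus a b d r < lam ∧ lam < betaPlus a b d r := by
  rw [RDSystem.TuringUnstable, and_iff_right (schnakenberg_kineticallyStable hab hr htr)]
  simp only [schnakenberg_isLinearizedEigenvalue_iff hab hd hr, betaMinus, betaPlus,
    ← quadratic_neg_iff hd]
  constructor
  · rintro ⟨β, ⟨lam, hlam, h⟩, hβ⟩
    exact ⟨lam, hlam,
      (exists_root_re_pos_iff (schnakenberg_damping_pos hd hr htr hlam.nonneg)).1 ⟨β, h, hβ⟩⟩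
  · rintro ⟨lam, hlam, h⟩
    obtain ⟨β, h, hβ⟩ :=
      (exists_root_re_pos_iff (schnakenberg_damping_pos hd hr htr hlam.nonneg)).2 h
    exact ⟨β, ⟨lam, hlam, h⟩, hβ⟩

end Schnakenberg

end TuringRD

theorem theorem5p1 {n : ℕ} (hn : 1 ≤ n) (Ω : Set (Space n)) (hΩo : IsOpen Ω)
    (hΩc : IsConnected Ω) (hΩb : Bornology.IsBounded Ω) (bc : BoundaryCondition)
    (a b d r : ℝ) (hab : 0 < a + b) (hd : 0 < d) (hr : 0 < r)
    (htr : (b - a) / (a + b) - (a + b) ^ 2 < 0) :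
    (schnakenberg a b d r).IsSteadyState (a + b) (b / (a + b) ^ 2) ∧
    -- the ranges in polynomial form
    ((-(√(4 * d) / (r * (a + b))) < d * ((b - a) / (a + b)) - (a + b) ^ 2 ∧
          d * ((b - a) / (a + b)) - (a + b) ^ 2 < 0) ↔
      (max d 1 * (b - a) < (a + b) ^ 3 ∧ (a + b) ^ 3 < d * (b - a) + √(4 * d) / r)) ∧
    (√(4 * d) / (r * (a + b)) < d * ((b - a) / (a + b)) - (a + b) ^ 2 ↔
      (b - a < (a + b) ^ 3 ∧ (a + b) ^ 3 < d * (b - a) - √(4 * d) / r)) ∧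
    (d * ((b - a) / (a + b)) - (a + b) ^ 2 < -(√(4 * d) / (r * (a + b))) ↔
      max (b - a) (d * (b - a) + √(4 * d) / r) < (a + b) ^ 3) ∧
    -- stability and instability, for the threshold `√(4d) / (r(a+b))` of the ranges above
    -- and for the threshold `√(4d)(a+b)`, at which the discriminant of `β₋, β₊` vanishes
    ∀ τ : ℝ, (τ = √(4 * d) / (r * (a + b)) ∨ τ = √(4 * d) * (a + b)) →
      ((-τ < d * ((b - a) / (a + b)) - (a + b) ^ 2 ∧
          d * ((b - a) / (a + b)) - (a + b) ^ 2 < 0) →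
        (schnakenberg a b d r).TuringStable Ω bc (a + b) (b / (a + b) ^ 2)) ∧
      ((τ < d * ((b - a) / (a + b)) - (a + b) ^ 2 ∨
          d * ((b - a) / (a + b)) - (a + b) ^ 2 < -τ) →
        ((schnakenberg a b d r).TuringUnstable Ω bc (a + b) (b / (a + b) ^ 2) ↔
          ∃ lam : ℝ, IsNegLaplacianEigenvalue Ω bc lam ∧
            betaMinus a b d r < lam ∧ lam < betaPlus a b d r)) := by
  refine ⟨schnakenberg_isSteadyState hab.ne', ?_, ?_, ?_, fun τ _ =>
    ⟨fun hX => schnakenberg_turingStable hab hd hr htr hX.2,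
      fun _ => schnakenberg_turingUnstable_iff hab hd hr htr⟩⟩
  all_goals
    -- The standing trace assumption multiplied by `a + b`; it supplies the conditions on `b - a` in
    -- the polynomial ranges.
    have hba : b - a < (a + b) ^ 3 := by
      have h := mul_lt_mul_of_pos_right htr hab
      rw [sub_mul, div_mul_cancel₀ _ hab.ne'] at h
      linarith
    have hX : d * ((b - a) / (a + b)) - (a + b) ^ 2
        = (d * (b - a) - (a + b) ^ 3) / (a + b) := by
      field_simp
    have hτ : √(4 * d) / (r * (a + b)) = √(4 * d) / r / (a + b) := (div_div _ _ _).symm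
  · rw [hX, hτ, ← neg_div, div_lt_div_iff_of_pos_right hab, div_lt_iff₀ hab, zero_mul]
    constructor
    · rintro ⟨h1, h2⟩
      refine ⟨?_, by linarith⟩
      rcases max_choice d 1 with h | h <;> rw [h] <;> linarith
    · rintro ⟨h1, h2⟩
      refine ⟨by linarith, ?_⟩
      -- For `b - a ≤ 0` the bound with `max d 1` does not control `d(b - a)`, but then `d(b - a) ≤
      -- 0 < (a + b)³`.
      rcases le_total 0 (b - a) with h | h
      · linarith [mul_le_mul_of_nonneg_right (le_max_left d 1) h]
      · linarith [mul_nonpos_of_nonneg_of_nonpos hd.le h, pow_pos hab 3]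
  · rw [hX, hτ, div_lt_div_iff_of_pos_right hab, and_iff_right hba]
    constructor <;> intro h <;> linarith
  · rw [hX, hτ, ← neg_div, div_lt_div_iff_of_pos_right hab, max_lt_iff, and_iff_right hba]
    constructor <;> intro h <;> linarith
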